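/- For a semigroup $S$ and $k\ge 1$ let $S^k$ be the set of all products of $k$ elements of $S$. A semigroup $S$ is nilpotent if $|S^{c+1}|=1$ for some integer $c\ge 0$; the least such $c$ is its class, and if $S$ is finite and nilpotent of class $c$, its coclass is $|S|-1-c$. Two semigroups are anti-isomorphic if one is isomorphic to the dual (opposite) of the other; "up to (anti-)isomorphism" means up to isomorphism or anti-isomorphism. Let $n\ge 6$ be an integer and consider the nilpotent semigroups of order $n$ and coclass $2$ which have a (with respect to inclusion) minimal generating set of size $3$. (i) Up to (anti-)isomorphism their number is $\frac18(21n^2+22n-96)$ if $n$ is even, and $\frac18(21n^2+36n-81)$ if $n$ is odd. (ii) Up to isomorphism their number is $\frac18(27n^2+94n-280)$ if $n$ is even, and $\frac18(27n^2+112n-243)$ if $n$ is odd. (iii) Up to isomorphism the number of commutative ones is $\frac18(15n^2-58n+24)$ if $n$ is even, and $\frac18(15n^2-48n+9)$ if $n$ is odd. -/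

import Mathlib

open scoped Pointwise

/-- `powSucc S k` is the set `S ^ (k + 1)` of all products of `k + 1` elements of `S`. -/
def powSucc (S : Type*) [Semigroup S] : ℕ → Set S
  | 0 => Set.univ
  | k + 1 => powSucc S k * Set.univ

/-- `S` is nilpotent of class `c`: the number `c` is the least one with `|S ^ (c + 1)| = 1`. -/
def HasNilpotencyClass (S : Type*) [Semigroup S] (c : ℕ) : Prop :=
  IsLeast {d : ℕ | (powSucc S d).ncard = 1} c

/-- `S` is finite and nilpotent of coclass `r`: its class `c` satisfies `|S| - 1 - c = r`
(as integers). -/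
def HasCoclass (S : Type*) [Semigroup S] (r : ℕ) : Prop :=
  Finite S ∧ ∃ c : ℕ, HasNilpotencyClass S c ∧ (Nat.card S : ℤ) - 1 - (c : ℤ) = (r : ℤ)

/-- `A` is a minimal (with respect to inclusion) generating set of the semigroup `S`. -/
def IsMinimalGeneratingSet (S : Type*) [Semigroup S] (A : Set S) : Prop :=
  Minimal (fun B : Set S => Subsemigroup.closure B = ⊤) A

/-- Nilpotent of coclass 2 with a minimal generating set of size 3. -/
def IsCoclassTwoThreeGenerated (S : Type*) [Semigroup S] : Prop :=
  HasCoclass S 2 ∧ ∃ A : Set S, IsMinimalGeneratingSet S A ∧ A.ncard = 3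

/-- The property above together with commutativity. -/
def IsCommCoclassTwoThreeGenerated (S : Type*) [Semigroup S] : Prop :=
  IsCoclassTwoThreeGenerated S ∧ ∀ x y : S, x * y = y * x

/-- `S` and `T` are isomorphic. -/
def Isomorphic (S T : Type*) [Semigroup S] [Semigroup T] : Prop :=
  Nonempty (S ≃* T)

/-- `S` and `T` are isomorphic or anti-isomorphic (`S` is isomorphic to the dual of `T`). -/
def IsoOrAntiIso (S T : Type*) [Semigroup S] [Semigroup T] : Prop :=
  Nonempty (S ≃* T) ∨ Nonempty (S ≃* Tᵐᵒᵖ)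

theorem isoOrAntiIso_symm {S T : Type*} [Semigroup S] [Semigroup T]
    (h : IsoOrAntiIso S T) : IsoOrAntiIso T S := by
  rcases h with ⟨⟨e⟩⟩ | ⟨⟨e⟩⟩
  · exact Or.inl ⟨e.symm⟩
  · exact Or.inr ⟨(MulEquiv.opOp T).trans (MulEquiv.op e.symm)⟩

theorem isoOrAntiIso_trans {S T U : Type*} [Semigroup S] [Semigroup T] [Semigroup U]
    (h : IsoOrAntiIso S T) (h' : IsoOrAntiIso T U) : IsoOrAntiIso S U := by
  rcases h with ⟨⟨e⟩⟩ | ⟨⟨e⟩⟩ <;> rcases h' with ⟨⟨f⟩⟩ | ⟨⟨f⟩⟩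
  · exact Or.inl ⟨e.trans f⟩
  · exact Or.inr ⟨e.trans f⟩
  · exact Or.inr ⟨e.trans (MulEquiv.op f)⟩
  · exact Or.inl ⟨(e.trans (MulEquiv.op f)).trans (MulEquiv.opOp U).symm⟩

/-- The semigroup structures on the `n`-element set `Fin n` that have the property `P`. -/
def SemigroupsOfOrder (n : ℕ) (P : (S : Type) → [Semigroup S] → Prop) : Type :=
  {M : Semigroup (Fin n) // @P (Fin n) M}

/-- Isomorphism as an equivalence relation on `SemigroupsOfOrder n P`. -/
def isoSetoid (n : ℕ) (P : (S : Type) → [Semigroup S] → Prop) :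
    Setoid (SemigroupsOfOrder n P) where
  r M N := @Isomorphic (Fin n) (Fin n) M.1 N.1
  iseqv :=
    { refl := fun M => ⟨@MulEquiv.refl (Fin n) M.1.toMul⟩
      symm := fun {M N} ⟨e⟩ => ⟨@MulEquiv.symm (Fin n) (Fin n) M.1.toMul N.1.toMul e⟩
      trans := fun {M N K} ⟨e⟩ ⟨f⟩ =>
        ⟨@MulEquiv.trans (Fin n) (Fin n) (Fin n) M.1.toMul N.1.toMul K.1.toMul e f⟩ }

/-- (Anti-)isomorphism as an equivalence relation on `SemigroupsOfOrder n P`. -/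
def isoOrAntiIsoSetoid (n : ℕ) (P : (S : Type) → [Semigroup S] → Prop) :
    Setoid (SemigroupsOfOrder n P) where
  r M N := @IsoOrAntiIso (Fin n) (Fin n) M.1 N.1
  iseqv :=
    { refl := fun M => Or.inl ⟨@MulEquiv.refl (Fin n) M.1.toMul⟩
      symm := fun {M N} h => @isoOrAntiIso_symm (Fin n) (Fin n) M.1 N.1 h
      trans := fun {M N K} h h' =>
        @isoOrAntiIso_trans (Fin n) (Fin n) (Fin n) M.1 N.1 K.1 h h' }

/-- The number, up to isomorphism, of semigroups of order `n` with the property `P`. -/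
noncomputable def numUpToIso (n : ℕ) (P : (S : Type) → [Semigroup S] → Prop) : ℕ :=
  Nat.card (Quotient (isoSetoid n P))

/-- The number, up to isomorphism or anti-isomorphism, of semigroups of order `n` with the
property `P`. -/
noncomputable def numUpToIsoOrAntiIso (n : ℕ) (P : (S : Type) → [Semigroup S] → Prop) : ℕ :=
  Nat.card (Quotient (isoOrAntiIsoSetoid n P))

/-! Write `K` for the class, so `n = K + 3` and `K ≥ 3`. In a nilpotent semigroup the only minimal
generating set is `S ∖ S²`, so `|S²| = K`. The chain `S² ⊃ S³ ⊃ … ⊃ S^(K+1) = {0}` is strict, hence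
loses exactly one element at each step. From this, some generator `w` has `S² = {w², …, w^(K+1) =
0}` (`exists_eq_sPow`).

Each `x` acts on the powers of `w` with a weight: `w² x = w^(2 + wt x)`, where the weight matters
only up to `K - 1`. Associativity forces `x y = w^(wt x + wt y)` when the sum is below `K`.
Otherwise `w x y = 0`, so `x y` is `w^K` or `0`, and this choice is free. Thus `S` is encoded by
weights `1 ≤ p ≤ q < K` and a Boolean matrix `f` supported on pairs of total weight at least `K`
(`exists_nonempty_mulEquiv_model`). Conversely, all such data give semigroups of the required kind.
Isomorphism means a weight-preserving permutation of the generators (`nonempty_mulEquiv_iff`),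
duality transposes `f`, and commutativity means that `f` is symmetric.

The number of orbits for given `p, q` depends only on which weights coincide and which sums of two
weights reach `K` (`orbitCount_congr`). So a handful of small cases, evaluated by `decide`, gives
every value, and summing over `p ≤ q < K` (`sum_orbitCount`) gives quadratic polynomials depending
on the parity of `K`. -/

/-! ### Powers of a nilpotent semigroup and its minimal generating set. -/

section PowSucc

variable {S T : Type*} [Semigroup S] [Semigroup T]

theorem mem_powSucc_succ {k : ℕ} {x : S} :
    x ∈ powSucc S (k + 1) ↔ ∃ s ∈ powSucc S k, ∃ t, s * t = x := by
  simp [powSucc, Set.mem_mul]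

theorem mem_powSucc_one {x : S} : x ∈ powSucc S 1 ↔ ∃ s t : S, s * t = x := by
  rw [mem_powSucc_succ]
  simp [powSucc]

theorem mul_mem_powSucc {a b : ℕ} {x y : S} (hx : x ∈ powSucc S a) (hy : y ∈ powSucc S b) :
    x * y ∈ powSucc S (a + b + 1) := by
  induction b generalizing y with
  | zero => exact mem_powSucc_succ.2 ⟨x, hx, y, rfl⟩
  | succ b ih =>
    obtain ⟨s, hs, t, rfl⟩ := mem_powSucc_succ.1 hy
    rw [← mul_assoc]
    exact mem_powSucc_succ.2 ⟨x * s, ih hs, t, rfl⟩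

theorem powSucc_succ_subset (k : ℕ) : powSucc S (k + 1) ⊆ powSucc S k := by
  induction k with
  | zero => exact Set.subset_univ _
  | succ k ih =>
    intro x hx
    obtain ⟨s, hs, t, rfl⟩ := mem_powSucc_succ.1 hx
    exact mem_powSucc_succ.2 ⟨s, ih hs, t, rfl⟩

theorem powSucc_antitone : Antitone (powSucc S) :=
  antitone_nat_of_succ_le powSucc_succ_subset

theorem MulEquiv.map_mem_powSucc (e : S ≃* T) {k : ℕ} {x : S} :
    e x ∈ powSucc T k ↔ x ∈ powSucc S k := by
  induction k generalizing x with
  | zero => simp [powSucc]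
  | succ k ih =>
    simp only [mem_powSucc_succ]
    constructor
    · rintro ⟨s, hs, t, h⟩
      refine ⟨e.symm s, ih.1 (by simpa using hs), e.symm t, ?_⟩
      rw [← map_mul, h, e.symm_apply_apply]
    · rintro ⟨s, hs, t, rfl⟩
      exact ⟨e s, ih.2 hs, e t, (map_mul e s t).symm⟩

theorem MulEquiv.image_powSucc (e : S ≃* T) (k : ℕ) : e '' powSucc S k = powSucc T k := by
  ext y
  constructor
  · rintro ⟨x, hx, rfl⟩
    exact e.map_mem_powSucc.2 hx
  · intro hy
    exact ⟨e.symm y, e.map_mem_powSucc.1 (by simpa using hy), by simp⟩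

theorem MulEquiv.ncard_powSucc (e : S ≃* T) (k : ℕ) :
    (powSucc S k).ncard = (powSucc T k).ncard := by
  rw [← e.image_powSucc, Set.ncard_image_of_injective _ e.injective]

/-- If two consecutive powers agreed, the chain would be constant from there on and would already be
a singleton before step `c`. -/
theorem HasNilpotencyClass.powSucc_ssubset {c k : ℕ} (h : HasNilpotencyClass S c) (hk : k < c) :
    powSucc S (k + 1) ⊂ powSucc S k := by
  refine (powSucc_succ_subset k).ssubset_of_ne fun heq => ?_
  have hconst : ∀ j, powSucc S (k + j) = powSucc S k := by
    intro j
    induction j with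
    | zero => rfl
    | succ j ih =>
      rw [← add_assoc, powSucc, ih]
      exact heq
  have h1 : (powSucc S c).ncard = 1 := h.1
  obtain ⟨j, rfl⟩ := Nat.exists_eq_add_of_lt hk
  rw [add_assoc, hconst] at h1
  have := h.2 h1
  omega

theorem HasNilpotencyClass.le_ncard_powSucc [Finite S] {c k : ℕ} (h : HasNilpotencyClass S c)
    (hk : k ≤ c) : k + 1 ≤ (powSucc S (c - k)).ncard := by
  induction k with
  | zero =>
    have h1 : (powSucc S c).ncard = 1 := h.1
    simp [h1]
  | succ k ih =>
    have h1 := ih (by omega)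
    have h2 := Set.ncard_lt_ncard (h.powSucc_ssubset (show c - (k + 1) < c by omega))
      (Set.toFinite _)
    rw [show c - (k + 1) + 1 = c - k by omega] at h2
    omega

/-- Factoring repeatedly, an element is either a product of irreducibles or lies in arbitrarily high
powers, hence is zero. Zero itself is a long power of an irreducible; `1 ≤ c` guarantees that one
exists. -/
theorem HasNilpotencyClass.closure_eq_top {c : ℕ} (h : HasNilpotencyClass S c) (hc : 1 ≤ c) :
    Subsemigroup.closure (powSucc S 1)ᶜ = ⊤ := by
  have key : ∀ k, ∀ x : S, x ∈ Subsemigroup.closure (powSucc S 1)ᶜ ∨ x ∈ powSucc S (k + 1) := by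
    intro k
    induction k with
    | zero =>
      intro x
      by_cases hx : x ∈ powSucc S 1
      · exact Or.inr hx
      · exact Or.inl (Subsemigroup.subset_closure hx)
    | succ k ih =>
      intro x
      by_cases hx : x ∈ powSucc S 1
      · obtain ⟨s, t, rfl⟩ := mem_powSucc_one.1 hx
        rcases ih s with hs | hs
        · rcases ih t with ht | ht
          · exact Or.inl (mul_mem hs ht)
          · right
            simpa [add_comm, add_assoc] using
              mul_mem_powSucc (show s ∈ powSucc S 0 from Set.mem_univ _) ht
        · exact Or.inr (mem_powSucc_succ.2 ⟨s, hs, t, rfl⟩)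
      · exact Or.inl (Subsemigroup.subset_closure hx)
  obtain ⟨z, hz⟩ := Set.ncard_eq_one.1 h.1
  obtain ⟨y, -, hy⟩ := Set.exists_of_ssubset (h.powSucc_ssubset (show 0 < c by omega))
  have hpow : ∀ k, ∃ x ∈ Subsemigroup.closure (powSucc S 1)ᶜ, x ∈ powSucc S k := by
    intro k
    induction k with
    | zero => exact ⟨y, Subsemigroup.subset_closure hy, Set.mem_univ _⟩
    | succ k ih =>
      obtain ⟨x, hx, hx'⟩ := ih
      exact ⟨x * y, mul_mem hx (Subsemigroup.subset_closure hy),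
        mem_powSucc_succ.2 ⟨x, hx', y, rfl⟩⟩
  rw [eq_top_iff]
  intro x _
  rcases key (c - 1) x with hx | hx
  · exact hx
  · rw [Nat.sub_add_cancel hc, hz] at hx
    obtain ⟨x', h1, h2⟩ := hpow c
    rw [hz] at h2
    rw [Set.mem_singleton_iff.1 hx, ← Set.mem_singleton_iff.1 h2]
    exact h1

theorem compl_powSucc_one_subset {A : Set S} (hA : Subsemigroup.closure A = ⊤) :
    (powSucc S 1)ᶜ ⊆ A := by
  intro x hx
  have hmem : x ∈ Subsemigroup.closure A := hA ▸ Subsemigroup.mem_top x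
  have hind : ∀ y ∈ Subsemigroup.closure A, y ∈ A ∨ y ∈ powSucc S 1 := by
    intro y hy
    induction hy using Subsemigroup.closure_induction with
    | mem y hy => exact Or.inl hy
    | mul a b _ _ _ _ => exact Or.inr (mem_powSucc_one.2 ⟨a, b, rfl⟩)
  exact (hind x hmem).resolve_right hx

theorem HasNilpotencyClass.isMinimalGeneratingSet_iff {c : ℕ} (h : HasNilpotencyClass S c)
    (hc : 1 ≤ c) {A : Set S} : IsMinimalGeneratingSet S A ↔ A = (powSucc S 1)ᶜ := by
  constructor
  · intro hA
    exact (hA.eq_of_subset (h.closure_eq_top hc) (compl_powSucc_one_subset hA.prop)).symm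
  · rintro rfl
    exact ⟨h.closure_eq_top hc, fun B hB _ => compl_powSucc_one_subset hB⟩

theorem isCoclassTwoThreeGenerated_iff {K : ℕ} (hK : 1 ≤ K) (hcard : Nat.card S = K + 3) :
    IsCoclassTwoThreeGenerated S ↔
      HasNilpotencyClass S K ∧ ((powSucc S 1)ᶜ : Set S).ncard = 3 := by
  constructor
  · rintro ⟨⟨-, c, hc, hcK⟩, A, hA, hA3⟩
    obtain rfl : c = K := by
      rw [hcard] at hcK
      push_cast at hcK
      omega
    rw [hc.isMinimalGeneratingSet_iff hK] at hA
    exact ⟨hc, hA ▸ hA3⟩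
  · rintro ⟨hc, h3⟩
    refine ⟨⟨Nat.finite_of_card_ne_zero (by omega), K, hc, ?_⟩, _,
      (hc.isMinimalGeneratingSet_iff hK).2 rfl, h3⟩
    rw [hcard]
    push_cast
    ring

theorem isCoclassTwoThreeGenerated_of_mulEquiv {K : ℕ} (hK : 1 ≤ K) (e : S ≃* T)
    (hcard : Nat.card T = K + 3) (h : HasNilpotencyClass T K)
    (h3 : ((powSucc T 1)ᶜ : Set T).ncard = 3) : IsCoclassTwoThreeGenerated S := by
  rw [isCoclassTwoThreeGenerated_iff hK ((Nat.card_congr e.toEquiv).trans hcard)]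
  constructor
  · simpa only [HasNilpotencyClass, e.ncard_powSucc] using h
  · rw [← e.image_powSucc, ← Set.image_compl_eq e.bijective,
      Set.ncard_image_of_injective _ e.injective] at h3
    exact h3

end PowSucc

/-! ### The model semigroup attached to combinatorial data. -/

/-- The weights of the three generators: the first generator has weight `1`. -/
def genWeight (p q : ℕ) : Fin 3 → ℕ := ![1, p, q]

/-- Combinatorial data describing a nilpotent semigroup of class `K`, order `K + 3`, with three
generators of weights `1 ≤ p ≤ q < K`. A product of two generators of weights adding up to at
least `K` is the last nonzero power if `f` is true, and zero otherwise. -/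
structure NilData (K : ℕ) where
  p : ℕ
  q : ℕ
  f : Fin 3 → Fin 3 → Bool
  one_le : 1 ≤ p
  le : p ≤ q
  lt : q < K
  supp : ∀ x y, f x y = true → K ≤ genWeight p q x + genWeight p q y

namespace NilData

variable {K : ℕ} (D : NilData K)

/-- The weights of the generators. -/
def wt : Fin 3 → ℕ := genWeight D.p D.q

theorem wt_zero : D.wt 0 = 1 := rfl

theorem one_le_wt (g : Fin 3) : 1 ≤ D.wt g := by
  have h1 := D.one_le
  have h2 := D.le
  fin_cases g <;> simp [wt, genWeight] <;> omega

theorem wt_lt (g : Fin 3) : D.wt g < K := by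
  have h1 := D.one_le
  have h2 := D.le
  have h3 := D.lt
  fin_cases g <;> simp [wt, genWeight] <;> omega

theorem wt_mono : Monotone D.wt := by
  have h1 := D.one_le
  have h2 := D.le
  intro x y hxy
  fin_cases x <;> fin_cases y <;> simp_all [wt, genWeight]
  omega

theorem f_eq_false {x y : Fin 3} (h : D.wt x + D.wt y < K) : D.f x y = false := by
  by_contra hf
  have := D.supp x y (by simpa using hf)
  rw [wt] at h
  omega

/-- The carrier of the semigroup: three generators and the powers `x ^ 2, …, x ^ (K + 1) = 0`
of the first generator `x`, where `Sum.inr i` stands for `x ^ (i + 2)`. -/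
def Model (_ : NilData K) : Type := Fin 3 ⊕ Fin K

/-- The generators. -/
def gen (g : Fin 3) : D.Model := Sum.inl g

/-- The powers of the first generator; the exponent is at least `2`. -/
def pw (e : ℕ) : D.Model :=
  Sum.inr ⟨min (e - 2) (K - 1), by have := D.lt; omega⟩

theorem cases_model (x : D.Model) :
    (∃ g, x = D.gen g) ∨ ∃ e, 2 ≤ e ∧ e ≤ K + 1 ∧ x = D.pw e := by
  rcases x with g | i
  · exact Or.inl ⟨g, rfl⟩
  · refine Or.inr ⟨i + 2, by omega, by omega, congrArg Sum.inr (Fin.ext ?_)⟩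
    simp only [Nat.add_sub_cancel]
    omega

theorem gen_injective : Function.Injective D.gen := Sum.inl_injective

theorem gen_ne_pw (g : Fin 3) (e : ℕ) : D.gen g ≠ D.pw e := Sum.inl_ne_inr

theorem pw_eq_pw_iff {a b : ℕ} (ha : 2 ≤ a) (hb : 2 ≤ b) :
    D.pw a = D.pw b ↔ min a (K + 1) = min b (K + 1) := by
  have := D.lt
  refine (Sum.inr_injective (α := Fin 3)).eq_iff.trans ?_
  rw [Fin.mk.injEq]
  omega

/-- The weight of an element. -/
def lvl : D.Model → ℕ
  | Sum.inl g => D.wt g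
  | Sum.inr i => i + 2

theorem lvl_gen (g : Fin 3) : D.lvl (D.gen g) = D.wt g := rfl

theorem lvl_pw {e : ℕ} (he : 2 ≤ e) : D.lvl (D.pw e) = min e (K + 1) := by
  have := D.lt
  simp only [lvl, pw]
  omega

theorem one_le_lvl (x : D.Model) : 1 ≤ D.lvl x := by
  rcases x with g | i
  · exact D.one_le_wt g
  · simp [lvl]

/-- The exponent of a product. -/
def expo : D.Model → D.Model → ℕ
  | Sum.inl g, Sum.inl h =>
    if D.f g h then K else if D.wt g + D.wt h < K then D.wt g + D.wt h else K + 1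
  | x, y => D.lvl x + D.lvl y

theorem expo_gen (g h : Fin 3) : D.expo (D.gen g) (D.gen h) =
    if D.f g h then K else if D.wt g + D.wt h < K then D.wt g + D.wt h else K + 1 := rfl

theorem expo_pw_left (e : ℕ) (x : D.Model) :
    D.expo (D.pw e) x = D.lvl (D.pw e) + D.lvl x := by
  rcases x with g | i <;> rfl

theorem expo_pw_right (e : ℕ) (x : D.Model) :
    D.expo x (D.pw e) = D.lvl x + D.lvl (D.pw e) := by
  rcases x with g | i <;> rfl

/-- The exponent of a product is additive in the levels, except that it may deviate where both
numbers are at least `K`. One more factor pushes both past `K`, to zero, so the deviation never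
affects triple products. -/
theorem expo_spec (x y : D.Model) : D.expo x y = D.lvl x + D.lvl y ∨
    (K ≤ D.lvl x + D.lvl y ∧ K ≤ D.expo x y) := by
  rcases x with g | i
  · rcases y with h | j
    · change D.expo (D.gen g) (D.gen h) = D.wt g + D.wt h ∨
        (K ≤ D.wt g + D.wt h ∧ K ≤ D.expo (D.gen g) (D.gen h))
      rw [expo_gen]
      by_cases hlt : D.wt g + D.wt h < K
      · left
        simp [D.f_eq_false hlt, hlt]
      · right
        refine ⟨by omega, ?_⟩
        split_ifs <;> omega
    · exact Or.inl rfl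
  · exact Or.inl (by rcases y with h | j <;> rfl)

theorem two_le_expo (hK : 2 ≤ K) (x y : D.Model) : 2 ≤ D.expo x y := by
  have := D.one_le_lvl x
  have := D.one_le_lvl y
  rcases D.expo_spec x y with h | h <;> omega

instance : Mul D.Model := ⟨fun x y => D.pw (D.expo x y)⟩

theorem mul_def (x y : D.Model) : x * y = D.pw (D.expo x y) := rfl

theorem two_le (D : NilData K) : 2 ≤ K := by
  have h1 := D.one_le
  have h2 := D.le
  have h3 := D.lt
  omega

instance : Semigroup D.Model where
  mul_assoc x y z := by
    have hK := D.two_le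
    have hx := D.one_le_lvl x
    have hy := D.one_le_lvl y
    have hz := D.one_le_lvl z
    have h1 := D.two_le_expo hK x y
    have h2 := D.two_le_expo hK y z
    simp only [mul_def]
    rw [expo_pw_left, expo_pw_right, lvl_pw _ h1, lvl_pw _ h2,
      pw_eq_pw_iff _ (by omega) (by omega)]
    rcases D.expo_spec x y with h | h <;> rcases D.expo_spec y z with h' | h' <;> omega

theorem pw_mul_gen {e : ℕ} (he : 2 ≤ e) (g : Fin 3) :
    D.pw e * D.gen g = D.pw (e + D.wt g) := by
  rw [mul_def, expo_pw_left, lvl_pw _ he, lvl_gen,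
    pw_eq_pw_iff _ (by have := D.two_le; have := D.one_le_wt g; omega) (by omega)]
  have := D.one_le_wt g
  omega

theorem gen_mul_gen (g h : Fin 3) : D.gen g * D.gen h =
    D.pw (if D.f g h then K else if D.wt g + D.wt h < K then D.wt g + D.wt h else K + 1) := rfl

theorem gen_zero_mul_gen_zero (hK : 3 ≤ K) : D.gen 0 * D.gen 0 = D.pw 2 := by
  have hlt : D.wt 0 + D.wt 0 < K := by simp only [wt_zero]; omega
  rw [gen_mul_gen, D.f_eq_false hlt, if_neg (by simp), if_pos hlt, wt_zero]

theorem pw_mem_powSucc (hK : 3 ≤ K) (k : ℕ) : D.pw (k + 2) ∈ powSucc D.Model (k + 1) := by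
  induction k with
  | zero => exact mem_powSucc_one.2 ⟨_, _, D.gen_zero_mul_gen_zero hK⟩
  | succ k ih =>
    exact mem_powSucc_succ.2 ⟨_, ih, D.gen 0, by rw [pw_mul_gen _ (by omega), wt_zero]⟩

theorem le_lvl_of_mem_powSucc {k : ℕ} {x : D.Model} (hx : x ∈ powSucc D.Model k) :
    min k K + 1 ≤ D.lvl x := by
  have hK := D.two_le
  induction k generalizing x with
  | zero => simpa using D.one_le_lvl x
  | succ k ih =>
    obtain ⟨s, hs, t, rfl⟩ := mem_powSucc_succ.1 hx
    have h1 := ih hs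
    have h2 := D.two_le_expo hK s t
    have h3 := D.one_le_lvl t
    rw [mul_def, lvl_pw _ h2]
    -- A generator is not a product, so it occurs as `s` only for `k = 0`; if `s` is a power, the
    -- exponent is exactly additive.
    rcases s with g | i
    · rcases k with _ | k
      · omega
      · obtain ⟨a, -, b, hab⟩ := mem_powSucc_succ.1 hs
        exact absurd hab.symm (D.gen_ne_pw g _)
    · have h4 : D.expo (Sum.inr i) t = D.lvl (Sum.inr i) + D.lvl t := by
        rcases t with h | j <;> rfl
      omega

theorem pw_mem_powSucc_iff (hK : 3 ≤ K) {k e : ℕ} (he : 2 ≤ e) (hk : k ≤ K) :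
    D.pw e ∈ powSucc D.Model k ↔ k + 1 ≤ e := by
  constructor
  · intro h
    have := D.le_lvl_of_mem_powSucc h
    rw [lvl_pw _ he] at this
    omega
  · intro h
    refine powSucc_antitone (show k ≤ (e - 2) + 1 by omega) ?_
    have := D.pw_mem_powSucc hK (e - 2)
    rwa [Nat.sub_add_cancel he] at this

theorem gen_notMem_powSucc_one (g : Fin 3) : D.gen g ∉ powSucc D.Model 1 := by
  intro h
  obtain ⟨a, b, hab⟩ := mem_powSucc_one.1 h
  exact D.gen_ne_pw g _ hab.symm

theorem hasNilpotencyClass (hK : 3 ≤ K) : HasNilpotencyClass D.Model K := by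
  constructor
  · refine Set.ncard_eq_one.2 ⟨D.pw (K + 1), ?_⟩
    ext x
    rw [Set.mem_singleton_iff]
    rcases D.cases_model x with ⟨g, rfl⟩ | ⟨e, h1, h2, rfl⟩
    · refine ⟨fun h => absurd (powSucc_antitone (show 1 ≤ K by omega) h)
        (D.gen_notMem_powSucc_one g), fun h => absurd h (D.gen_ne_pw g _)⟩
    · rw [D.pw_mem_powSucc_iff hK h1 le_rfl, D.pw_eq_pw_iff h1 (by omega)]
      omega
  · intro d hd
    by_contra hlt
    obtain ⟨z, hz⟩ := Set.ncard_eq_one.1 hd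
    have h1 := (D.pw_mem_powSucc_iff hK (k := d) (e := K) (by omega) (by omega)).2 (by omega)
    have h2 := (D.pw_mem_powSucc_iff hK (k := d) (e := K + 1) (by omega) (by omega)).2 (by omega)
    rw [hz] at h1 h2
    have h3 : D.pw K = D.pw (K + 1) :=
      (Set.mem_singleton_iff.1 h1).trans (Set.mem_singleton_iff.1 h2).symm
    rw [D.pw_eq_pw_iff (by omega) (by omega)] at h3
    omega

theorem compl_powSucc_one (hK : 3 ≤ K) : (powSucc D.Model 1)ᶜ = Set.range D.gen := by
  ext x
  rw [Set.mem_compl_iff]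
  rcases D.cases_model x with ⟨g, rfl⟩ | ⟨e, h1, h2, rfl⟩
  · simp [D.gen_notMem_powSucc_one g]
  · simp only [D.pw_mem_powSucc_iff hK h1 (show 1 ≤ K by omega), Set.mem_range]
    refine ⟨fun h => absurd h1 h, ?_⟩
    rintro ⟨g, hg⟩
    exact absurd hg (D.gen_ne_pw g e)

theorem ncard_compl_powSucc_one (hK : 3 ≤ K) : ((powSucc D.Model 1)ᶜ : Set D.Model).ncard = 3 := by
  rw [D.compl_powSucc_one hK, ← Set.image_univ, Set.ncard_image_of_injective _ D.gen_injective]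
  simp [Set.ncard_univ]

instance : Fintype D.Model := inferInstanceAs (Fintype (Fin 3 ⊕ Fin K))

theorem card_model : Nat.card D.Model = K + 3 := by
  rw [Nat.card_eq_fintype_card]
  change Fintype.card (Fin 3 ⊕ Fin K) = K + 3
  simp [add_comm]

theorem isCoclassTwoThreeGenerated_of_mulEquiv (hK : 3 ≤ K) {S : Type*} [Semigroup S]
    (e : S ≃* D.Model) : IsCoclassTwoThreeGenerated S :=
  _root_.isCoclassTwoThreeGenerated_of_mulEquiv (by omega) e D.card_model
    (D.hasNilpotencyClass hK) (D.ncard_compl_powSucc_one hK)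

end NilData

/-! ### Isomorphism, duality and commutativity in terms of the data. -/

namespace NilData

variable {K : ℕ}

/-- Two data differ by a weight preserving permutation of the generators. -/
def Conj (D E : NilData K) : Prop :=
  D.p = E.p ∧ D.q = E.q ∧ ∃ σ : Equiv.Perm (Fin 3),
    (∀ x, D.wt (σ x) = D.wt x) ∧ ∀ x y, E.f (σ x) (σ y) = D.f x y

theorem wt_eq {D E : NilData K} (hp : D.p = E.p) (hq : D.q = E.q) : D.wt = E.wt := by
  unfold wt
  rw [hp, hq]

theorem Conj.nonempty_mulEquiv {D E : NilData K} (h : D.Conj E) :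
    Nonempty (D.Model ≃* E.Model) := by
  obtain ⟨hp, hq, σ, hσ, hf⟩ := h
  have hwt := wt_eq hp hq
  refine ⟨⟨Equiv.sumCongr σ (Equiv.refl (Fin K)), ?_⟩⟩
  intro x y
  rcases x with g | i
  · rcases y with h | j
    · change E.pw (D.expo (D.gen g) (D.gen h)) = E.pw (E.expo (E.gen (σ g)) (E.gen (σ h)))
      rw [expo_gen, expo_gen, hf, ← hwt, hσ, hσ]
    · change E.pw (D.wt g + (j + 2)) = E.pw (E.wt (σ g) + (j + 2))
      rw [← hwt, hσ]
  · rcases y with h | j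
    · change E.pw ((i + 2) + D.wt h) = E.pw ((i + 2) + E.wt (σ h))
      rw [← hwt, hσ]
    · rfl

/-- Among the elements of `S²`, a power is determined by which of the ideals `powSucc` contain it,
and isomorphisms preserve these. -/
theorem mulEquiv_pw {D E : NilData K} (hK : 3 ≤ K) (e : D.Model ≃* E.Model) {a : ℕ}
    (ha : 2 ≤ a) : e (D.pw a) = E.pw a := by
  have hmem : ∀ k, e (D.pw a) ∈ powSucc E.Model k ↔ D.pw a ∈ powSucc D.Model k :=
    fun k => e.map_mem_powSucc
  rcases E.cases_model (e (D.pw a)) with ⟨g, hg⟩ | ⟨b, h1, h2, hb⟩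
  · refine absurd ((hmem 1).2 ((D.pw_mem_powSucc_iff hK ha (by omega)).2 ha)) ?_
    rw [hg]
    exact E.gen_notMem_powSucc_one g
  · have key : ∀ k ≤ K, k + 1 ≤ b ↔ k + 1 ≤ a := by
      intro k hk
      rw [← D.pw_mem_powSucc_iff hK ha hk, ← E.pw_mem_powSucc_iff hK h1 hk, ← hb, hmem]
    rw [hb, pw_eq_pw_iff _ h1 ha]
    have k1 := key (b - 1) (by omega)
    have k2 := key (min (a - 1) K) (by omega)
    omega

/-- Irreducibles go to irreducibles, which gives `σ`. Weights are read off from multiplication on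
the square `pw 2`, and `f` from the products whose weights add up to at least `K`. -/
theorem conj_of_mulEquiv {D E : NilData K} (hK : 3 ≤ K) (e : D.Model ≃* E.Model) :
    D.Conj E := by
  have hgen : ∀ {D E : NilData K} (e : D.Model ≃* E.Model) (g : Fin 3),
      ∃ h, e (D.gen g) = E.gen h := by
    intro D E e g
    rcases E.cases_model (e (D.gen g)) with h | ⟨b, h1, -, hb⟩
    · exact h
    · exfalso
      refine D.gen_notMem_powSucc_one g (e.map_mem_powSucc.1 ?_)
      rw [hb, pw_mem_powSucc_iff _ hK h1 (by omega)]
      exact h1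
  choose s hs using hgen e
  have hs_inj : Function.Injective s := by
    intro x y hxy
    apply D.gen_injective
    apply e.injective
    rw [hs, hs, hxy]
  let σ : Equiv.Perm (Fin 3) := Equiv.ofBijective s (Finite.injective_iff_bijective.1 hs_inj)
  have hwt : ∀ x, E.wt (σ x) = D.wt x := by
    intro x
    have h1 := congrArg e (D.pw_mul_gen le_rfl x)
    rw [map_mul, mulEquiv_pw hK e le_rfl, mulEquiv_pw hK e (by omega), hs,
      E.pw_mul_gen le_rfl, pw_eq_pw_iff _ (by omega) (by omega)] at h1
    have h2 := D.wt_lt x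
    have h3 := E.wt_lt (s x)
    change E.wt (s x) = D.wt x
    omega
  -- Both weight tuples are sorted and are rearrangements of each other, hence equal.
  have heq : D.wt = E.wt := by
    have h1 := Tuple.comp_sort_eq_comp_iff_monotone (f := E.wt) (σ := σ)
    have h2 : E.wt ∘ σ = D.wt := funext hwt
    have h3 := h1.2 (h2 ▸ D.wt_mono)
    have h4 := (Tuple.comp_sort_eq_comp_iff_monotone (f := E.wt) (σ := 1)).2
      (by simpa using E.wt_mono)
    rw [← h2, h3, ← h4]
    rfl
  refine ⟨congrFun heq 1, congrFun heq 2, σ, fun x => by rw [congrFun heq, hwt], fun x y => ?_⟩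
  by_cases hlt : D.wt x + D.wt y < K
  · rw [D.f_eq_false hlt, E.f_eq_false (by rwa [hwt, hwt])]
  · have h1 := congrArg e (D.gen_mul_gen x y)
    rw [map_mul, hs, hs, mulEquiv_pw hK e, gen_mul_gen, pw_eq_pw_iff] at h1
    · change min (if E.f (σ x) (σ y) then K else
        if E.wt (σ x) + E.wt (σ y) < K then E.wt (σ x) + E.wt (σ y) else K + 1) (K + 1) = _ at h1
      rw [hwt, hwt, if_neg hlt] at h1
      cases hE : E.f (σ x) (σ y) <;> cases hD : D.f x y <;> simp [hE, hD] at h1 ⊢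
    all_goals
      have := E.one_le_wt (s x)
      have := E.one_le_wt (s y)
      split_ifs <;> omega

theorem nonempty_mulEquiv_iff {D E : NilData K} (hK : 3 ≤ K) :
    Nonempty (D.Model ≃* E.Model) ↔ D.Conj E :=
  ⟨fun ⟨e⟩ => conj_of_mulEquiv hK e, Conj.nonempty_mulEquiv⟩

/-- The data of the dual semigroup. -/
def transpose (D : NilData K) : NilData K :=
  { D with
    f := fun x y => D.f y x
    supp := fun x y h => by rw [add_comm]; exact D.supp y x h }

/-- The semigroup of the transposed data is the dual semigroup. -/
def transposeEquiv (D : NilData K) : D.transpose.Model ≃* D.Modelᵐᵒᵖ where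
  toEquiv := MulOpposite.opEquiv (α := D.Model)
  map_mul' x y := by
    refine congrArg MulOpposite.op (congrArg D.pw ?_ :
      D.pw (D.transpose.expo x y) = D.pw (D.expo y x))
    rcases x with g | i <;> rcases y with h | j
    · change (if D.f h g then K else if D.wt g + D.wt h < K then D.wt g + D.wt h else K + 1) =
        if D.f h g then K else if D.wt h + D.wt g < K then D.wt h + D.wt g else K + 1
      rw [add_comm (D.wt g)]
    all_goals exact add_comm _ _

theorem nonempty_mulEquiv_op_iff {D E : NilData K} (hK : 3 ≤ K) :
    Nonempty (D.Model ≃* E.Modelᵐᵒᵖ) ↔ D.Conj E.transpose := by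
  rw [← nonempty_mulEquiv_iff hK]
  exact ⟨fun ⟨e⟩ => ⟨e.trans E.transposeEquiv.symm⟩, fun ⟨e⟩ => ⟨e.trans E.transposeEquiv⟩⟩

theorem mul_comm_iff (D : NilData K) :
    (∀ x y : D.Model, x * y = y * x) ↔ ∀ x y, D.f x y = D.f y x := by
  have hK := D.two_le
  constructor
  · intro h x y
    have h1 := h (D.gen x) (D.gen y)
    have h2 := D.one_le_wt x
    have h3 := D.one_le_wt y
    rw [gen_mul_gen, gen_mul_gen, pw_eq_pw_iff _ (by split_ifs <;> omega)
      (by split_ifs <;> omega), add_comm (D.wt y)] at h1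
    by_cases hlt : D.wt x + D.wt y < K
    · rw [D.f_eq_false hlt, D.f_eq_false (by omega)]
    · rw [if_neg hlt] at h1
      cases hE : D.f x y <;> cases hD : D.f y x <;> simp [hE, hD] at h1 ⊢
  · intro h x y
    rw [mul_def, mul_def]
    congr 1
    rcases x with g | i <;> rcases y with k | j
    · change D.expo (D.gen g) (D.gen k) = D.expo (D.gen k) (D.gen g)
      rw [expo_gen, expo_gen, h g k, add_comm (D.wt g)]
    all_goals exact add_comm _ _

end NilData

/-! ### Every semigroup of the required kind is a model. -/

section Classification

variable {S : Type*} [Semigroup S]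

/-- The power `w ^ (k + 1)`. -/
def sPow (w : S) : ℕ → S
  | 0 => w
  | k + 1 => sPow w k * w

theorem sPow_mul_sPow (w : S) (a b : ℕ) : sPow w a * sPow w b = sPow w (a + b + 1) := by
  induction b with
  | zero => rfl
  | succ b ih => rw [sPow, ← mul_assoc, ih]; rfl

theorem mul_sPow (w : S) (a : ℕ) : w * sPow w a = sPow w (a + 1) := by
  have h := sPow_mul_sPow w 0 a
  rwa [zero_add] at h

theorem sPow_mem_powSucc (w : S) (k : ℕ) : sPow w k ∈ powSucc S k := by
  induction k with
  | zero => exact Set.mem_univ _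
  | succ k ih => exact mem_powSucc_succ.2 ⟨_, ih, w, rfl⟩

/-- If the factor `S ^ 2 / S ^ 3` has only one nonzero element, then some `w` generates all the
factors `S ^ (k + 1) / S ^ (k + 2)` with `k ≥ 1`. -/
theorem exists_eq_sPow {K : ℕ} (hK : 3 ≤ K) (h : HasNilpotencyClass S K)
    (h2 : (powSucc S 1 \ powSucc S 2).Subsingleton) :
    ∃ w : S, ∀ k, 1 ≤ k → ∀ z ∈ powSucc S k, z ∉ powSucc S (k + 1) → z = sPow w k := by
  have mem0 : ∀ x : S, x ∈ powSucc S 0 := fun x => Set.mem_univ x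
  -- Take `abc ∉ S⁴`. Then `ab` and `bc` both avoid `S³`, so `ab = bc` and `abc = b(cc)`; hence `cc
  -- ∉ S³`, and `w = c` works.
  obtain ⟨z, hz, hz3⟩ := Set.exists_of_ssubset (h.powSucc_ssubset (show 2 < K by omega))
  obtain ⟨s, hs, c, rfl⟩ := mem_powSucc_succ.1 hz
  obtain ⟨a, b, rfl⟩ := mem_powSucc_one.1 hs
  have hab2 : a * b ∉ powSucc S 2 := fun h' => hz3 (mul_mem_powSucc h' (mem0 c))
  have hbc : b * c ∈ powSucc S 1 := mem_powSucc_one.2 ⟨_, _, rfl⟩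
  have hbc2 : b * c ∉ powSucc S 2 := by
    intro h'
    rw [mul_assoc] at hz3
    exact hz3 (mul_mem_powSucc (mem0 a) h')
  have hcc : c * c ∈ powSucc S 1 := mem_powSucc_one.2 ⟨_, _, rfl⟩
  have hcc2 : c * c ∉ powSucc S 2 := by
    intro h'
    rw [h2 ⟨hs, hab2⟩ ⟨hbc, hbc2⟩, mul_assoc] at hz3
    exact hz3 (mul_mem_powSucc (mem0 b) h')
  refine ⟨c, fun k hk => ?_⟩
  induction k, hk using Nat.le_induction with
  | base => exact fun z hz hz' => h2 ⟨hz, hz'⟩ ⟨hcc, hcc2⟩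
  | succ k hk ih =>
    intro z hz hz'
    obtain ⟨s, hs, t, rfl⟩ := mem_powSucc_succ.1 hz
    obtain rfl := ih s hs (fun h' => hz' (mem_powSucc_succ.2 ⟨s, h', t, rfl⟩))
    obtain ⟨k, rfl⟩ := Nat.exists_eq_add_of_le' hk
    rw [sPow, mul_assoc] at hz' ⊢
    have ht : c * t = c * c := by
      refine h2 ⟨mem_powSucc_one.2 ⟨_, _, rfl⟩, fun h' => hz' ?_⟩ ⟨hcc, hcc2⟩
      exact mul_mem_powSucc (sPow_mem_powSucc c k) h'
    rw [ht, ← mul_assoc]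
    rfl

end Classification

section Classification

variable {S : Type*} [Semigroup S]

theorem HasNilpotencyClass.sPow_notMem {K : ℕ} (h : HasNilpotencyClass S K) (hK : 2 ≤ K) {w : S}
    (hw : ∀ k, 1 ≤ k → ∀ z ∈ powSucc S k, z ∉ powSucc S (k + 1) → z = sPow w k) {k : ℕ}
    (hk : k < K) : sPow w k ∉ powSucc S (k + 1) := by
  have key : ∀ k, 1 ≤ k → k < K → sPow w k ∉ powSucc S (k + 1) := by
    intro k hk1 hk
    obtain ⟨z, hz, hz'⟩ := Set.exists_of_ssubset (h.powSucc_ssubset hk)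
    rwa [← hw k hk1 z hz hz']
  rcases k with _ | k
  · exact fun hmem => key 1 le_rfl (by omega) (mem_powSucc_succ.2 ⟨w, hmem, w, rfl⟩)
  · exact key _ (by omega) hk

theorem HasNilpotencyClass.sPow_eq_iff {K : ℕ} (h : HasNilpotencyClass S K) (hK : 2 ≤ K) {w : S}
    (hw : ∀ k, 1 ≤ k → ∀ z ∈ powSucc S k, z ∉ powSucc S (k + 1) → z = sPow w k) {a b : ℕ} :
    sPow w a = sPow w b ↔ min a K = min b K := by
  constructor
  · intro hab
    have key : ∀ {a b}, sPow w a = sPow w b → a < b → K ≤ a := by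
      intro a b hab hlt
      by_contra hlt'
      refine h.sPow_notMem hK hw (show a < K by omega) ?_
      rw [hab]
      exact powSucc_antitone (show a + 1 ≤ b by omega) (sPow_mem_powSucc w b)
    rcases lt_trichotomy a b with hlt | rfl | hlt
    · have := key hab hlt
      omega
    · rfl
    · have := key hab.symm hlt
      omega
  · intro hab
    rcases eq_or_ne a b with rfl | hne
    · rfl
    · obtain ⟨z, hz⟩ := Set.ncard_eq_one.1 h.1
      have h1 := powSucc_antitone (show K ≤ a by omega) (sPow_mem_powSucc w a)
      have h2 := powSucc_antitone (show K ≤ b by omega) (sPow_mem_powSucc w b)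
      rw [hz] at h1 h2
      exact (Set.mem_singleton_iff.1 h1).trans (Set.mem_singleton_iff.1 h2).symm

theorem HasNilpotencyClass.exists_sPow_eq {K : ℕ} (h : HasNilpotencyClass S K) (hK : 2 ≤ K) {w : S}
    (hw : ∀ k, 1 ≤ k → ∀ z ∈ powSucc S k, z ∉ powSucc S (k + 1) → z = sPow w k) {x : S}
    (hx : x ∈ powSucc S 1) : ∃ k, 1 ≤ k ∧ k ≤ K ∧ x = sPow w k := by
  have key : ∀ m, x ∈ powSucc S (m + 1) ∨ ∃ k, 1 ≤ k ∧ k ≤ m ∧ x = sPow w k := by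
    intro m
    induction m with
    | zero => exact Or.inl hx
    | succ m ih =>
      rcases ih with ih | ⟨k, h1, h2, h3⟩
      · by_cases hm : x ∈ powSucc S (m + 1 + 1)
        · exact Or.inl hm
        · exact Or.inr ⟨m + 1, by omega, le_rfl, hw _ (by omega) x ih hm⟩
      · exact Or.inr ⟨k, h1, by omega, h3⟩
  rcases key K with hm | hm
  · obtain ⟨z, hz⟩ := Set.ncard_eq_one.1 h.1
    have h1 := powSucc_succ_subset K hm
    have h2 := sPow_mem_powSucc w K
    rw [hz] at h1 h2
    exact ⟨K, by omega, le_rfl, (Set.mem_singleton_iff.1 h1).trans (Set.mem_singleton_iff.1 h2).symm⟩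
  · exact hm

theorem exists_nonempty_mulEquiv_model {K : ℕ} (hK : 3 ≤ K) (hcard : Nat.card S = K + 3)
    (hS : IsCoclassTwoThreeGenerated S) : ∃ D : NilData K, Nonempty (S ≃* D.Model) := by
  obtain ⟨h, h3⟩ := (isCoclassTwoThreeGenerated_iff (by omega) hcard).1 hS
  have : Finite S := Nat.finite_of_card_ne_zero (by omega)
  have hsub : (powSucc S 1 \ powSucc S 2).Subsingleton := by
    have h1 := Set.ncard_add_ncard_compl (powSucc S 1)
    have h2 := h.le_ncard_powSucc (show K - 2 ≤ K by omega)
    -- Counting: `|S²| = K` and `|S³| ≥ K - 1`, so `S² ∖ S³` has at most one element.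
    rw [show K - (K - 2) = 2 by omega] at h2
    have h4 := Set.ncard_sdiff_add_ncard_of_subset (powSucc_succ_subset (S := S) 1)
    have h5 : (powSucc S 1 \ powSucc S 2).ncard ≤ 1 := by
      change (powSucc S 1 \ powSucc S 2).ncard + (powSucc S 2).ncard = _ at h4
      omega
    exact fun x hx y hy => (Set.ncard_le_one_iff (Set.toFinite _)).1 h5 hx hy
  obtain ⟨w, hw⟩ := exists_eq_sPow hK h hsub
  have sPow_eq := @HasNilpotencyClass.sPow_eq_iff S _ K h (by omega) w hw
  have ex_mul : ∀ x y : S, ∃ k, 1 ≤ k ∧ k ≤ K ∧ x * y = sPow w k := fun x y =>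
    h.exists_sPow_eq (by omega) hw (mem_powSucc_one.2 ⟨x, y, rfl⟩)
  choose ι hι1 hιK hι using fun x => ex_mul w x
  have sPow_mul : ∀ k y, sPow w k * y = if k = 0 then w * y else sPow w (k + ι y) := by
    intro k y
    rcases k with _ | k
    · rfl
    · rw [sPow, mul_assoc, hι, sPow_mul_sPow, if_neg (by omega)]
      congr 1
      omega
  choose ε _ hεK hε using ex_mul
  -- Compare `w (x y)` with `(w x) y`: this fixes `x y` unless both vanish.
  have hει : ∀ x y, min (ε x y + 1) K = min (ι x + ι y) K := by
    intro x y
    rw [← sPow_eq]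
    have h1 : sPow w (ε x y + 1) = w * (x * y) := by
      rw [hε x y, mul_sPow]
    rw [h1, ← mul_assoc, hι, sPow_mul, if_neg (by have := hι1 x; omega)]
  have hιw : ι w = 1 := by
    have h1 : sPow w 1 = sPow w (ι w) := hι w
    rw [sPow_eq] at h1
    have := hιK w
    omega
  -- The values `K - 1` and `K` of `ι` differ only in whether `w x` is `w^K` or `0`, which `f`
  -- records; on `w²` and above both act as zero.
  let d : S → ℕ := fun x => min (ι x) (K - 1)
  have hd : ∀ x, d x = min (ι x) (K - 1) := fun _ => rfl
  have e3 : Nat.card ((powSucc S 1)ᶜ : Set S) = 3 := h3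
  let b := (Finite.equivFinOfCardEq e3).symm
  let g : Fin 3 → S := fun i => (b (Tuple.sort (fun i => d (b i)) i) : S)
  have hg_mono : Monotone (d ∘ g) := Tuple.monotone_sort (fun i => d (b i))
  have hg_inj : Function.Injective g := fun i j hij =>
    (Tuple.sort _).injective (b.injective (Subtype.ext hij))
  have hg_mem : ∀ i, g i ∉ powSucc S 1 := fun i => (b _).2
  have hg_surj : ∀ x, x ∉ powSucc S 1 → ∃ i, g i = x := by
    intro x hx
    refine ⟨(Tuple.sort (fun i => d (b i))).symm (b.symm ⟨x, hx⟩), ?_⟩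
    simp [g]
  have hg0 : d (g 0) = 1 := by
    obtain ⟨j, hj⟩ := hg_surj w (h.sPow_notMem (by omega) hw (show 0 < K by omega))
    have h1 : d (g 0) ≤ d (g j) := hg_mono (Fin.zero_le j)
    have h2 := hι1 (g 0)
    rw [hj, hd, hd, hιw] at h1
    rw [hd]
    omega
  have hwt : genWeight (d (g 1)) (d (g 2)) = fun i => d (g i) := by
    funext i
    fin_cases i
    · exact hg0.symm
    · rfl
    · rfl
  let D : NilData K :=
    { p := d (g 1)
      q := d (g 2)
      -- Since `sPow w k` is `w^(k + 1)`, the value `K - 1` of `ε` stands for `w^K`, the last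
      -- nonzero power.
      f := fun x y => decide (K ≤ d (g x) + d (g y) ∧ ε (g x) (g y) = K - 1)
      one_le := by rw [hd]; have := hι1 (g 1); omega
      le := hg_mono (show (1 : Fin 3) ≤ 2 by decide)
      lt := by rw [hd]; omega
      supp := fun x y hxy => by rw [hwt]; exact (of_decide_eq_true hxy).1 }
  have hDwt : ∀ i, D.wt i = d (g i) := fun i => congrFun hwt i
  have hDf : ∀ x y, D.f x y = decide (K ≤ d (g x) + d (g y) ∧ ε (g x) (g y) = K - 1) :=
    fun _ _ => rfl
  let φ : D.Model → S := Sum.elim g (fun i => sPow w (i + 1))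
  have hφ_gen : ∀ i, φ (D.gen i) = g i := fun _ => rfl
  have hφ_inr : ∀ i : Fin K, φ (Sum.inr i) = sPow w (i + 1) := fun _ => rfl
  have hφ_pw : ∀ e, 2 ≤ e → φ (D.pw e) = sPow w (e - 1) := by
    intro e he
    rw [NilData.pw, hφ_inr, sPow_eq]
    dsimp only
    omega
  have hφ_pw_mem : ∀ i : Fin K, φ (Sum.inr i) ∈ powSucc S 1 := fun i =>
    powSucc_antitone (show 1 ≤ (i : ℕ) + 1 by omega) (sPow_mem_powSucc w _)
  have hφ_bij : Function.Bijective φ := by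
    constructor
    · rintro (x | i) (y | j) hxy
      · exact congrArg D.gen (hg_inj hxy)
      · exact absurd (by rw [← hφ_gen x]; exact hxy ▸ hφ_pw_mem j) (hg_mem x)
      · exact absurd (by rw [← hφ_gen y]; exact hxy ▸ hφ_pw_mem i) (hg_mem y)
      · rw [hφ_inr, hφ_inr, sPow_eq] at hxy
        exact congrArg Sum.inr (Fin.ext (by omega))
    · intro x
      by_cases hx : x ∈ powSucc S 1
      · obtain ⟨k, h1, h2, rfl⟩ := h.exists_sPow_eq (by omega) hw hx
        exact ⟨D.pw (k + 1), hφ_pw _ (by omega)⟩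
      · obtain ⟨i, rfl⟩ := hg_surj x hx
        exact ⟨D.gen i, rfl⟩
  have hφ_mul : ∀ x y, φ (x * y) = φ x * φ y := by
    intro x y
    rw [NilData.mul_def, hφ_pw _ (D.two_le_expo (by omega) x y)]
    rcases x with x | i <;> rcases y with y | j
    · change sPow w (D.expo (D.gen x) (D.gen y) - 1) = g x * g y
      rw [hε, sPow_eq, D.expo_gen, hDwt, hDwt, hDf]
      have h1 := hει (g x) (g y)
      have h2 := hι1 (g x)
      have h4 := hι1 (g y)
      have h5 := hεK (g x) (g y)
      have h6 := hd (g x)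
      have h7 := hd (g y)
      by_cases hlt : d (g x) + d (g y) < K
      · rw [if_neg (by simp; omega), if_pos hlt]
        omega
      · by_cases hε' : ε (g x) (g y) = K - 1
        · rw [if_pos (by simp; omega)]
          omega
        · rw [if_neg (by simp; omega), if_neg hlt]
          omega
    · change sPow w (D.wt x + (j + 2) - 1) = g x * sPow w (j + 1)
      -- Only left multiplication by `w` was used to define `ι`; the relation for `ε` transfers it
      -- to `g x * w`.
      have h0 : g x * sPow w (j + 1) = g x * w * sPow w j := by
        rw [mul_assoc, mul_sPow]
      rw [h0, hε (g x) w, sPow_mul_sPow, sPow_eq, hDwt, hd]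
      have h1 := hει (g x) w
      have h2 := hι1 (g x)
      omega
    · change sPow w (i + 2 + D.wt y - 1) = sPow w (i + 1) * g y
      rw [sPow_mul, if_neg (by omega), sPow_eq, hDwt, hd]
      omega
    · change sPow w (i + 2 + (j + 2) - 1) = sPow w (i + 1) * sPow w (j + 1)
      rw [sPow_mul_sPow]
      congr 1
      omega
  exact ⟨D, ⟨(MulEquiv.ofBijective (MulHom.mk φ hφ_mul) hφ_bij).symm⟩⟩

end Classification

/-! ### Counting orbits through representatives of minimal code. -/

/-- The number with the binary digits `f x y`. -/
def pairCode (f : Fin 3 → Fin 3 → Bool) : ℕ :=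
  (f 0 0).toNat + 2 * ((f 0 1).toNat + 2 * ((f 0 2).toNat + 2 * ((f 1 0).toNat + 2 *
    ((f 1 1).toNat + 2 * ((f 1 2).toNat + 2 * ((f 2 0).toNat + 2 *
      ((f 2 1).toNat + 2 * (f 2 2).toNat)))))))

theorem pairCode_injective : Function.Injective pairCode := by
  have key : ∀ {a b : Bool} {m n : ℕ}, a.toNat + 2 * m = b.toNat + 2 * n → a = b ∧ m = n := by
    rintro (_ | _) (_ | _) m n h <;> simp at h ⊢ <;> omega
  intro f g h
  obtain ⟨h0, h⟩ := key h
  obtain ⟨h1, h⟩ := key h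
  obtain ⟨h2, h⟩ := key h
  obtain ⟨h3, h⟩ := key h
  obtain ⟨h4, h⟩ := key h
  obtain ⟨h5, h⟩ := key h
  obtain ⟨h6, h⟩ := key h
  obtain ⟨h7, h⟩ := key h
  have h8 : f 2 2 = g 2 2 := (key (m := 0) (n := 0) (by omega)).1
  funext x y
  fin_cases x <;> fin_cases y <;> assumption

/-- The Boolean part `f` of a datum with weights `1, p, q` has minimal code among the data that
differ from it by a weight preserving permutation, and by transposition if `t` is true; if `s` is
true, then `f` is required to be symmetric. -/
def IsCanonical (t s : Bool) (K p q : ℕ) (f : Fin 3 → Fin 3 → Bool) : Prop :=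
  (∀ x y, f x y = true → K ≤ genWeight p q x + genWeight p q y) ∧
  (s = true → ∀ x y, f x y = f y x) ∧
  ∀ σ : Equiv.Perm (Fin 3), (∀ x, genWeight p q (σ x) = genWeight p q x) →
    pairCode f ≤ pairCode (fun x y => f (σ x) (σ y)) ∧
    (t = true → pairCode f ≤ pairCode (fun x y => f (σ y) (σ x)))

instance (t s : Bool) (K p q : ℕ) : DecidablePred (IsCanonical t s K p q) := fun f => by
  unfold IsCanonical
  infer_instance

/-- The number of orbits of data with weights `1, p, q`. -/
def orbitCount (t s : Bool) (K p q : ℕ) : ℕ :=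
  (Finset.univ.filter (IsCanonical t s K p q)).card

theorem orbitCount_congr (t s : Bool) {K p q K' p' q' : ℕ}
    (h1 : (1 = p ↔ 1 = p') ∧ (1 = q ↔ 1 = q') ∧ (p = q ↔ p' = q'))
    (h2 : (K ≤ 2 ↔ K' ≤ 2) ∧ (K ≤ 1 + p ↔ K' ≤ 1 + p') ∧ (K ≤ 1 + q ↔ K' ≤ 1 + q') ∧
      (K ≤ p + p ↔ K' ≤ p' + p') ∧ (K ≤ p + q ↔ K' ≤ p' + q') ∧ (K ≤ q + q ↔ K' ≤ q' + q')) :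
    orbitCount t s K p q = orbitCount t s K' p' q' := by
  obtain ⟨a1, a2, a3⟩ := h1
  obtain ⟨b1, b2, b3, b4, b5, b6⟩ := h2
  have e1 : ∀ x y, genWeight p q x = genWeight p q y ↔ genWeight p' q' x = genWeight p' q' y := by
    intro x y
    fin_cases x <;> fin_cases y <;> simp [genWeight] <;> omega
  have e2 : ∀ x y, K ≤ genWeight p q x + genWeight p q y ↔
      K' ≤ genWeight p' q' x + genWeight p' q' y := by
    intro x y
    fin_cases x <;> fin_cases y <;> simp [genWeight] <;> omega
  have e3 : ∀ f, IsCanonical t s K p q f ↔ IsCanonical t s K' p' q' f := by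
    intro f
    simp only [IsCanonical, e1, e2]
  simp only [orbitCount, e3]

namespace NilData

variable {K : ℕ}

/-- Equivalence of data: conjugacy, up to transposition if `t` is true. -/
def Rel (t : Bool) (D E : NilData K) : Prop :=
  D.Conj E ∨ (t = true ∧ D.Conj E.transpose)

theorem Rel.p_eq {t : Bool} {D E : NilData K} (h : D.Rel t E) : D.p = E.p := by
  rcases h with h | ⟨-, h⟩
  · exact h.1
  · exact h.1

theorem Rel.q_eq {t : Bool} {D E : NilData K} (h : D.Rel t E) : D.q = E.q := by
  rcases h with h | ⟨-, h⟩
  · exact h.2.1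
  · exact h.2.1

theorem Rel.pairCode_le {t s : Bool} {D E : NilData K}
    (h : D.Rel t E) (hE : IsCanonical t s K E.p E.q E.f) : pairCode E.f ≤ pairCode D.f := by
  rcases h with ⟨hp, hq, σ, hσ, hf⟩ | ⟨ht, hp, hq, σ, hσ, hf⟩
  · have := (hE.2.2 σ (fun x => by rw [← hp, ← hq]; exact hσ x)).1
    simpa only [hf] using this
  · have := (hE.2.2 σ (fun x => by
      rw [← show D.p = E.p from hp, ← show D.q = E.q from hq]; exact hσ x)).2 ht
    have hf' : (fun x y => E.f (σ y) (σ x)) = D.f := by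
      funext x y
      exact hf x y
    rwa [hf'] at this

theorem isCanonical_of_forall_le {t s : Bool} {E : NilData K}
    (hs : s = true → ∀ x y, E.f x y = E.f y x)
    (h : ∀ D : NilData K, (s = true → ∀ x y, D.f x y = D.f y x) → D.Rel t E →
      pairCode E.f ≤ pairCode D.f) : IsCanonical t s K E.p E.q E.f := by
  refine ⟨E.supp, hs, fun σ hσ => ⟨?_, fun ht => ?_⟩⟩
  · let D : NilData K := { E with
      f := fun x y => E.f (σ x) (σ y)
      supp := fun x y hxy => by rw [← hσ x, ← hσ y]; exact E.supp _ _ hxy }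
    exact h D (fun hs' x y => hs hs' _ _) (Or.inl ⟨rfl, rfl, σ, hσ, fun _ _ => rfl⟩)
  · let D : NilData K := { E with
      f := fun x y => E.f (σ y) (σ x)
      supp := fun x y hxy => by
        rw [← hσ x, ← hσ y, add_comm]; exact E.supp _ _ hxy }
    exact h D (fun hs' x y => hs hs' _ _) (Or.inr ⟨ht, rfl, rfl, σ, hσ, fun _ _ => rfl⟩)

/-- Each class contains exactly one matrix of minimal code for its weights, because `pairCode` is
injective. Stated for an abstract setoid so that it serves all three counts. -/
theorem card_quotient_eq_sum {X : Type*} (r : Setoid X) (t s : Bool)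
    (toX : {D : NilData K // s = true → ∀ x y, D.f x y = D.f y x} → X)
    (hsurj : ∀ x, ∃ D, r.r (toX D) x)
    (hrel : ∀ D E, r.r (toX D) (toX E) ↔ D.1.Rel t E.1) :
    Nat.card (Quotient r) =
      ∑ q ∈ Finset.Icc 1 (K - 1), ∑ p ∈ Finset.Icc 1 q, orbitCount t s K p q := by
  obtain ⟨F, hF, hcard⟩ : ∃ F : Finset (Σ _ : ℕ, Σ _ : ℕ, Fin 3 → Fin 3 → Bool),
      (∀ {a : Σ _ : ℕ, Σ _ : ℕ, Fin 3 → Fin 3 → Bool}, a ∈ F ↔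
        (1 ≤ a.1 ∧ a.1 ≤ K - 1) ∧ (1 ≤ a.2.1 ∧ a.2.1 ≤ a.1) ∧
          IsCanonical t s K a.2.1 a.1 a.2.2) ∧
      F.card = ∑ q ∈ Finset.Icc 1 (K - 1), ∑ p ∈ Finset.Icc 1 q, orbitCount t s K p q := by
    refine ⟨(Finset.Icc 1 (K - 1)).sigma fun q => (Finset.Icc 1 q).sigma fun p =>
      Finset.univ.filter (IsCanonical t s K p q), ?_, ?_⟩
    · intro a
      simp [Finset.mem_sigma]
    · simp only [Finset.card_sigma, orbitCount]
  rw [← hcard, ← Fintype.card_coe, ← Nat.card_eq_fintype_card]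
  let toD : F → {D : NilData K // s = true → ∀ x y, D.f x y = D.f y x} := fun a =>
    ⟨{ p := a.1.2.1
       q := a.1.1
       f := a.1.2.2
       one_le := (hF.1 a.2).2.1.1
       le := (hF.1 a.2).2.1.2
       lt := by have := (hF.1 a.2).1; omega
       supp := (hF.1 a.2).2.2.1 }, (hF.1 a.2).2.2.2.1⟩
  have hcanon : ∀ a, IsCanonical t s K (toD a).1.p (toD a).1.q (toD a).1.f :=
    fun a => (hF.1 a.2).2.2
  symm
  refine Nat.card_eq_of_bijective (fun a => Quotient.mk r (toX (toD a))) ⟨?_, ?_⟩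
  · intro a b hab
    have h1 : r.r (toX (toD a)) (toX (toD b)) := Quotient.exact hab
    have h2 := (hrel _ _).1 h1
    have h3 := (hrel _ _).1 (r.iseqv.symm h1)
    have hf : (toD a).1.f = (toD b).1.f := pairCode_injective
      (le_antisymm (h3.pairCode_le (hcanon a))
        (h2.pairCode_le (hcanon b)))
    have hp : a.1.2.1 = b.1.2.1 := h2.p_eq
    have hq : a.1.1 = b.1.1 := h2.q_eq
    obtain ⟨⟨qa, pa, fa⟩, ha⟩ := a
    obtain ⟨⟨qb, pb, fb⟩, hb⟩ := b
    replace hf : fa = fb := hf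
    simp only at hp hq
    subst hf hp hq
    rfl
  · intro x
    induction x using Quotient.inductionOn with | _ x => ?_
    obtain ⟨D, hD, hmin⟩ := (measure fun D : {D : NilData K //
      s = true → ∀ x y, D.f x y = D.f y x} => pairCode D.1.f).wf.has_min
      {D | r.r (toX D) x} (hsurj x)
    have hc : IsCanonical t s K D.1.p D.1.q D.1.f := by
      refine isCanonical_of_forall_le D.2 fun E hE hED => not_lt.1 fun hlt => ?_
      exact hmin ⟨E, hE⟩ (r.iseqv.trans ((hrel ⟨E, hE⟩ D).2 hED) hD) hlt
    have h1 := D.1.one_le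
    have h2 := D.1.le
    have h3 := D.1.lt
    exact ⟨⟨⟨D.1.q, D.1.p, D.1.f⟩, hF.2 ⟨⟨by simp only; omega, by simp only; omega⟩, ⟨h1, h2⟩, hc⟩⟩,
      Quotient.sound hD⟩

end NilData

/-! ### Transport of the models to `Fin (K + 3)`. -/

theorem isomorphic_congr {S S' T T' : Type*} [Semigroup S] [Semigroup S'] [Semigroup T]
    [Semigroup T'] (e : S ≃* S') (e' : T ≃* T') : Isomorphic S T ↔ Nonempty (S' ≃* T') :=
  ⟨fun ⟨φ⟩ => ⟨(e.symm.trans φ).trans e'⟩, fun ⟨φ⟩ => ⟨(e.trans φ).trans e'.symm⟩⟩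

theorem isoOrAntiIso_congr {S S' T T' : Type*} [Semigroup S] [Semigroup S'] [Semigroup T]
    [Semigroup T'] (e : S ≃* S') (e' : T ≃* T') :
    IsoOrAntiIso S T ↔ Nonempty (S' ≃* T') ∨ Nonempty (S' ≃* T'ᵐᵒᵖ) :=
  or_congr (isomorphic_congr e e') (isomorphic_congr e (MulEquiv.op e'))

theorem mul_comm_congr {S T : Type*} [Semigroup S] [Semigroup T] (e : S ≃* T) :
    (∀ x y : S, x * y = y * x) ↔ ∀ x y : T, x * y = y * x := by
  constructor
  · intro h x y
    apply e.symm.injective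
    rw [map_mul, map_mul, h]
  · intro h x y
    apply e.injective
    rw [map_mul, map_mul, h]

namespace NilData

variable {K : ℕ}

/-- A numbering of the elements of the model. -/
noncomputable def finEquiv (D : NilData K) : Fin (K + 3) ≃ D.Model :=
  (Finite.equivFinOfCardEq D.card_model).symm

/-- The model as a semigroup structure on `Fin (K + 3)`. -/
@[reducible]
noncomputable def finSemigroup (D : NilData K) : Semigroup (Fin (K + 3)) :=
  D.finEquiv.semigroup

/-- The isomorphism from the semigroup structure on `Fin (K + 3)` to the model. -/
noncomputable def finMulEquiv (D : NilData K) :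
    @MulEquiv (Fin (K + 3)) D.Model D.finSemigroup.toMul _ :=
  D.finEquiv.mulEquiv

theorem isCoclassTwoThreeGenerated_finSemigroup (hK : 3 ≤ K) (D : NilData K) :
    @IsCoclassTwoThreeGenerated (Fin (K + 3)) D.finSemigroup :=
  @isCoclassTwoThreeGenerated_of_mulEquiv K D hK (Fin (K + 3)) D.finSemigroup D.finMulEquiv

theorem exists_isomorphic_finSemigroup (hK : 3 ≤ K) (M : Semigroup (Fin (K + 3)))
    (hM : @IsCoclassTwoThreeGenerated (Fin (K + 3)) M) :
    ∃ D : NilData K, @Isomorphic (Fin (K + 3)) (Fin (K + 3)) D.finSemigroup M ∧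
      Nonempty (@MulEquiv (Fin (K + 3)) D.Model M.toMul _) := by
  obtain ⟨D, ⟨e⟩⟩ := @exists_nonempty_mulEquiv_model (Fin (K + 3)) M K hK (by simp) hM
  exact ⟨D, (@isomorphic_congr (Fin (K + 3)) D.Model (Fin (K + 3)) D.Model D.finSemigroup _ M _
    D.finMulEquiv e).2 ⟨MulEquiv.refl _⟩, ⟨e⟩⟩

theorem isomorphic_finSemigroup_iff (hK : 3 ≤ K) (D E : NilData K) :
    @Isomorphic (Fin (K + 3)) (Fin (K + 3)) D.finSemigroup E.finSemigroup ↔ D.Rel false E := by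
  rw [@isomorphic_congr (Fin (K + 3)) D.Model (Fin (K + 3)) E.Model D.finSemigroup _
    E.finSemigroup _ D.finMulEquiv E.finMulEquiv, nonempty_mulEquiv_iff hK]
  simp [Rel]

theorem isoOrAntiIso_finSemigroup_iff (hK : 3 ≤ K) (D E : NilData K) :
    @IsoOrAntiIso (Fin (K + 3)) (Fin (K + 3)) D.finSemigroup E.finSemigroup ↔ D.Rel true E := by
  rw [@isoOrAntiIso_congr (Fin (K + 3)) D.Model (Fin (K + 3)) E.Model D.finSemigroup _
    E.finSemigroup _ D.finMulEquiv E.finMulEquiv, nonempty_mulEquiv_iff hK,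
    nonempty_mulEquiv_op_iff hK]
  simp [Rel]

end NilData

theorem numUpToIso_eq_sum {K : ℕ} (hK : 3 ≤ K) :
    numUpToIso (K + 3) (fun S [Semigroup S] => IsCoclassTwoThreeGenerated S) =
      ∑ q ∈ Finset.Icc 1 (K - 1), ∑ p ∈ Finset.Icc 1 q, orbitCount false false K p q := by
  refine NilData.card_quotient_eq_sum _ false false
    (fun D => ⟨D.1.finSemigroup, D.1.isCoclassTwoThreeGenerated_finSemigroup hK⟩) ?_ ?_
  · rintro ⟨M, hM⟩
    obtain ⟨D, hD, -⟩ := NilData.exists_isomorphic_finSemigroup hK M hM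
    exact ⟨⟨D, by simp⟩, hD⟩
  · exact fun D E => NilData.isomorphic_finSemigroup_iff hK D.1 E.1

theorem numUpToIsoOrAntiIso_eq_sum {K : ℕ} (hK : 3 ≤ K) :
    numUpToIsoOrAntiIso (K + 3) (fun S [Semigroup S] => IsCoclassTwoThreeGenerated S) =
      ∑ q ∈ Finset.Icc 1 (K - 1), ∑ p ∈ Finset.Icc 1 q, orbitCount true false K p q := by
  refine NilData.card_quotient_eq_sum _ true false
    (fun D => ⟨D.1.finSemigroup, D.1.isCoclassTwoThreeGenerated_finSemigroup hK⟩) ?_ ?_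
  · rintro ⟨M, hM⟩
    obtain ⟨D, hD, -⟩ := NilData.exists_isomorphic_finSemigroup hK M hM
    exact ⟨⟨D, by simp⟩, Or.inl hD⟩
  · exact fun D E => NilData.isoOrAntiIso_finSemigroup_iff hK D.1 E.1

theorem numUpToIso_comm_eq_sum {K : ℕ} (hK : 3 ≤ K) :
    numUpToIso (K + 3) (fun S [Semigroup S] => IsCommCoclassTwoThreeGenerated S) =
      ∑ q ∈ Finset.Icc 1 (K - 1), ∑ p ∈ Finset.Icc 1 q, orbitCount false true K p q := by
  refine NilData.card_quotient_eq_sum _ false true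
    (fun D => ⟨D.1.finSemigroup, D.1.isCoclassTwoThreeGenerated_finSemigroup hK,
      (@mul_comm_congr (Fin (K + 3)) D.1.Model D.1.finSemigroup _ D.1.finMulEquiv).2
        (D.1.mul_comm_iff.2 (D.2 rfl))⟩) ?_ ?_
  · rintro ⟨M, hM, hcomm⟩
    obtain ⟨D, hD, ⟨e⟩⟩ := NilData.exists_isomorphic_finSemigroup hK M hM
    exact ⟨⟨D, fun _ => D.mul_comm_iff.1 ((@mul_comm_congr (Fin (K + 3)) D.Model M _ e).1 hcomm)⟩,
      hD⟩
  · exact fun D E => NilData.isomorphic_finSemigroup_iff hK D.1 E.1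

/-! ### Evaluating the sum over the weights. -/

theorem sum_Ico_eq_of_forall_eq {m n v : ℕ} {f : ℕ → ℕ} (hmn : m ≤ n)
    (hf : ∀ p, m ≤ p → p < n → f p = v) :
    ((∑ p ∈ Finset.Ico m n, f p : ℕ) : ℚ) = ((n : ℚ) - m) * v := by
  rw [Finset.sum_congr rfl (fun p hp => hf p (Finset.mem_Ico.1 hp).1 (Finset.mem_Ico.1 hp).2),
    Finset.sum_const, Nat.card_Ico, smul_eq_mul]
  push_cast [hmn]
  ring

theorem sum_Ico_eq_of_forall_eq_linear {m n : ℕ} {f : ℕ → ℕ} (a b : ℚ) (hmn : m ≤ n)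
    (hf : ∀ p, m ≤ p → p < n → (f p : ℚ) = a + b * p) :
    ((∑ p ∈ Finset.Ico m n, f p : ℕ) : ℚ) =
      a * (n - m) + b * ((n : ℚ) * (n - 1) - m * (m - 1)) / 2 := by
  induction n, hmn using Nat.le_induction with
  | base => simp
  | succ n hmn ih =>
    rw [Finset.sum_Ico_succ_top hmn]
    push_cast
    rw [← Nat.cast_sum, ih (fun p h1 h2 => hf p h1 (by omega)), hf n hmn (by omega)]
    ring

set_option maxRecDepth 10000 in
theorem orbitCount_eq_one (t s : Bool) :
    orbitCount t s 3 1 1 = 1 ∧ orbitCount t s 5 1 2 = 1 ∧ orbitCount t s 7 2 3 = 1 ∧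
      orbitCount t s 5 2 2 = 1 := by
  revert t s
  decide +kernel

set_option maxRecDepth 10000 in
theorem orbitCount_eq_two (t s : Bool) :
    orbitCount t s 4 1 2 = 2 ∧ orbitCount t s 6 2 3 = 2 := by
  revert t s
  decide +kernel

/-- No sum of two weights reaches `K`, so `f = 0`; the four cases are the possible coincidences
among `1, p, q`. -/
theorem orbitCount_of_two_mul_lt (t s : Bool) {K p q : ℕ} (hp : 1 ≤ p) (hpq : p ≤ q) (hK : 3 ≤ K)
    (hq : 2 * q < K) : orbitCount t s K p q = 1 := by
  obtain ⟨e1, e2, e3, e4⟩ := orbitCount_eq_one t s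
  rcases hp.eq_or_lt with rfl | hp1
  · rcases hpq.eq_or_lt with rfl | hpq1
    · rw [← e1]
      apply orbitCount_congr <;> omega
    · rw [← e2]
      apply orbitCount_congr <;> omega
  · rcases hpq.eq_or_lt with rfl | hpq1
    · rw [← e4]
      apply orbitCount_congr <;> omega
    · rw [← e3]
      apply orbitCount_congr <;> omega

/-- Here `p < q` and only the entry `f 2 2` is free; it is fixed by every symmetry. -/
theorem orbitCount_of_add_lt (t s : Bool) {K p q : ℕ} (hp : 1 ≤ p) (hpq : p + q < K)
    (hq : K ≤ 2 * q) (hq1 : q + 1 < K) : orbitCount t s K p q = 2 := by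
  obtain ⟨e1, e2⟩ := orbitCount_eq_two t s
  rcases hp.eq_or_lt with rfl | hp1
  · rw [← e1]
    apply orbitCount_congr <;> omega
  · rw [← e2]
    apply orbitCount_congr <;> omega

/-- Here `h = ⌈K / 2⌉` is the least weight whose double reaches `K`. As `p` grows, the entries for
`p + q` become free at `p = K - q`, the one for `2 p` at `p = h`, and at `p = q` a swap symmetry
appears. -/
theorem sum_orbitCount_of_lt (t s : Bool) {K h : ℕ} (hK : 3 ≤ K) (h1 : K ≤ 2 * h)
    (h2 : 2 * h ≤ K + 1) {q : ℕ} (hq : h ≤ q) (hq1 : q + 1 < K) :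
    ((∑ p ∈ Finset.Ico 1 (q + 1), orbitCount t s K p q : ℕ) : ℚ) =
      2 * (K - q - 1) + orbitCount t s 5 2 3 * (h - K + q) + orbitCount t s 6 3 4 * (q - h) +
        orbitCount t s 4 2 2 := by
  rw [Finset.sum_Ico_succ_top (by omega),
    ← Finset.sum_Ico_consecutive _ (show 1 ≤ K - q by omega) (show K - q ≤ q by omega),
    ← Finset.sum_Ico_consecutive _ (show K - q ≤ h by omega) hq]
  simp only [Nat.cast_add]
  rw [sum_Ico_eq_of_forall_eq (v := 2) (by omega)
      (fun p _ _ => orbitCount_of_add_lt t s (by omega) (by omega) (by omega) (by omega)),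
    sum_Ico_eq_of_forall_eq (v := orbitCount t s 5 2 3) (by omega)
      (fun p _ _ => by apply orbitCount_congr <;> omega),
    sum_Ico_eq_of_forall_eq (v := orbitCount t s 6 3 4) hq
      (fun p _ _ => by apply orbitCount_congr <;> omega),
    show orbitCount t s K q q = orbitCount t s 4 2 2 by apply orbitCount_congr <;> omega,
    Nat.cast_sub (by omega)]
  push_cast
  ring

/-- For `q = K - 1` even the products with the generator of weight `1` are free, so this row is
separate. Its ends `p = 1` and `p = K - 1` each have a swap symmetry. -/
theorem sum_orbitCount_last (t s : Bool) {K h : ℕ} (hK : 3 ≤ K) (h1 : K ≤ 2 * h) (h2 : 2 * h ≤ K + 1) :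
    ((∑ p ∈ Finset.Ico 1 K, orbitCount t s K p (K - 1) : ℕ) : ℚ) =
      orbitCount t s 3 1 2 + orbitCount t s 5 2 4 * (h - 2) +
        orbitCount t s 4 2 3 * (K - 1 - h) + orbitCount t s 3 2 2 := by
  obtain ⟨m, rfl⟩ := Nat.exists_eq_add_of_le' (show 1 ≤ K by omega)
  rw [Finset.sum_Ico_succ_top (by omega), Finset.sum_eq_sum_Ico_succ_bot (by omega),
    ← Finset.sum_Ico_consecutive _ (show 1 + 1 ≤ h by omega) (show h ≤ m by omega)]
  simp only [Nat.cast_add, Nat.add_sub_cancel]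
  rw [sum_Ico_eq_of_forall_eq (v := orbitCount t s 5 2 4) (by omega)
      (fun p _ _ => by apply orbitCount_congr <;> omega),
    sum_Ico_eq_of_forall_eq (v := orbitCount t s 4 2 3) (by omega)
      (fun p _ _ => by apply orbitCount_congr <;> omega),
    show orbitCount t s (m + 1) 1 m = orbitCount t s 3 1 2 by apply orbitCount_congr <;> omega,
    show orbitCount t s (m + 1) m m = orbitCount t s 3 2 2 by apply orbitCount_congr <;> omega]
  push_cast
  ring

theorem sum_orbitCount (t s : Bool) {K h : ℕ} (hK : 3 ≤ K) (h1 : K ≤ 2 * h) (h2 : 2 * h ≤ K + 1) :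
    ((∑ q ∈ Finset.Icc 1 (K - 1), ∑ p ∈ Finset.Icc 1 q, orbitCount t s K p q : ℕ) : ℚ) =
      h * (h - 1) / 2 +
      ((2 * (K - 1) + orbitCount t s 5 2 3 * (h - K) - orbitCount t s 6 3 4 * h +
          orbitCount t s 4 2 2) * (K - 1 - h) +
        (orbitCount t s 5 2 3 + orbitCount t s 6 3 4 - 2) *
          (((K : ℚ) - 1) * (K - 2) - h * (h - 1)) / 2) +
      (orbitCount t s 3 1 2 + orbitCount t s 5 2 4 * (h - 2) +
        orbitCount t s 4 2 3 * (K - 1 - h) + orbitCount t s 3 2 2) := by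
  have e : ∀ n, Finset.Icc 1 n = Finset.Ico 1 (n + 1) := fun n => by ext; simp
  simp only [e]
  rw [Finset.sum_Ico_succ_top (by omega),
    ← Finset.sum_Ico_consecutive _ (show 1 ≤ h by omega) (show h ≤ K - 1 by omega)]
  simp only [Nat.cast_add, Nat.sub_add_cancel (show 1 ≤ K by omega)]
  rw [sum_orbitCount_last t s hK h1 h2,
    -- For `q < h` every summand is `1`, so the row contributes `q`.
    sum_Ico_eq_of_forall_eq_linear 0 1 (by omega) (fun q _ _ => by
      rw [sum_Ico_eq_of_forall_eq (v := 1) (by omega)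
        (fun p _ _ => orbitCount_of_two_mul_lt t s (by omega) (by omega) hK (by omega))]
      push_cast
      ring),
    sum_Ico_eq_of_forall_eq_linear
      (2 * (K - 1) + orbitCount t s 5 2 3 * (h - K) - orbitCount t s 6 3 4 * h +
          orbitCount t s 4 2 2) (orbitCount t s 5 2 3 + orbitCount t s 6 3 4 - 2) (by omega)
      (fun q _ _ => by
        rw [sum_orbitCount_of_lt t s hK h1 h2 (by omega) (by omega)]
        ring), Nat.cast_sub (by omega)]
  push_cast
  ring

set_option maxRecDepth 10000 in
theorem orbitCount_false_false :
    orbitCount false false 3 1 2 = 20 ∧ orbitCount false false 5 2 3 = 8 ∧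
    orbitCount false false 6 3 4 = 16 ∧ orbitCount false false 4 2 2 = 10 ∧
    orbitCount false false 5 2 4 = 32 ∧ orbitCount false false 4 2 3 = 64 ∧
    orbitCount false false 3 2 2 = 136 := by
  decide +kernel

set_option maxRecDepth 10000 in
theorem orbitCount_true_false :
    orbitCount true false 3 1 2 = 14 ∧ orbitCount true false 5 2 3 = 6 ∧
    orbitCount true false 6 3 4 = 12 ∧ orbitCount true false 4 2 2 = 9 ∧
    orbitCount true false 5 2 4 = 20 ∧ orbitCount true false 4 2 3 = 40 ∧
    orbitCount true false 3 2 2 = 84 := by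
  decide +kernel

set_option maxRecDepth 10000 in
theorem orbitCount_false_true :
    orbitCount false true 3 1 2 = 6 ∧ orbitCount false true 5 2 3 = 4 ∧
    orbitCount false true 6 3 4 = 8 ∧ orbitCount false true 4 2 2 = 6 ∧
    orbitCount false true 5 2 4 = 8 ∧ orbitCount false true 4 2 3 = 16 ∧
    orbitCount false true 3 2 2 = 20 := by
  decide +kernel

theorem mainTheorem8 (n : ℕ) (hn : 6 ≤ n) :
    (Even n →
      (numUpToIsoOrAntiIso n (fun S [Semigroup S] => IsCoclassTwoThreeGenerated S) : ℚ)
        = 1 / 8 * (21 * (n : ℚ) ^ 2 + 22 * (n : ℚ) - 96)) ∧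
    (Odd n →
      (numUpToIsoOrAntiIso n (fun S [Semigroup S] => IsCoclassTwoThreeGenerated S) : ℚ)
        = 1 / 8 * (21 * (n : ℚ) ^ 2 + 36 * (n : ℚ) - 81)) ∧
    (Even n →
      (numUpToIso n (fun S [Semigroup S] => IsCoclassTwoThreeGenerated S) : ℚ)
        = 1 / 8 * (27 * (n : ℚ) ^ 2 + 94 * (n : ℚ) - 280)) ∧
    (Odd n →
      (numUpToIso n (fun S [Semigroup S] => IsCoclassTwoThreeGenerated S) : ℚ)
        = 1 / 8 * (27 * (n : ℚ) ^ 2 + 112 * (n : ℚ) - 243)) ∧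
    (Even n →
      (numUpToIso n (fun S [Semigroup S] => IsCommCoclassTwoThreeGenerated S) : ℚ)
        = 1 / 8 * (15 * (n : ℚ) ^ 2 - 58 * (n : ℚ) + 24)) ∧
    (Odd n →
      (numUpToIso n (fun S [Semigroup S] => IsCommCoclassTwoThreeGenerated S) : ℚ)
        = 1 / 8 * (15 * (n : ℚ) ^ 2 - 48 * (n : ℚ) + 9)) := by
  obtain ⟨K, rfl⟩ := Nat.exists_eq_add_of_le' (show 3 ≤ n by omega)
  have hK : 3 ≤ K := by omega
  rw [numUpToIso_eq_sum hK, numUpToIsoOrAntiIso_eq_sum hK, numUpToIso_comm_eq_sum hK]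
  obtain ⟨a1, a2, a3, a4, a5, a6, a7⟩ := orbitCount_false_false
  obtain ⟨b1, b2, b3, b4, b5, b6, b7⟩ := orbitCount_true_false
  obtain ⟨c1, c2, c3, c4, c5, c6, c7⟩ := orbitCount_false_true
  -- In both parities `h = r - 1` is `⌈K / 2⌉`; the parity of `n` is opposite to that of `K`.
  have even_case : Even (K + 3) → ∃ h : ℕ, K ≤ 2 * h ∧ 2 * h ≤ K + 1 ∧ (K : ℚ) = 2 * h - 1 := by
    rintro ⟨r, hr⟩
    refine ⟨r - 1, by omega, by omega, ?_⟩
    rw [Nat.cast_sub (by omega)]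
    have : (K : ℚ) + 3 = r + r := by exact_mod_cast hr
    push_cast
    linarith
  have odd_case : Odd (K + 3) → ∃ h : ℕ, K ≤ 2 * h ∧ 2 * h ≤ K + 1 ∧ (K : ℚ) = 2 * h := by
    rintro ⟨r, hr⟩
    refine ⟨r - 1, by omega, by omega, ?_⟩
    rw [Nat.cast_sub (by omega)]
    have : (K : ℚ) + 3 = 2 * r + 1 := by exact_mod_cast hr
    push_cast
    linarith
  refine ⟨fun hn => ?_, fun hn => ?_, fun hn => ?_, fun hn => ?_, fun hn => ?_, fun hn => ?_⟩
  · obtain ⟨h, h1, h2, h3⟩ := even_case hn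
    rw [sum_orbitCount true false hK h1 h2, b1, b2, b3, b4, b5, b6, b7]
    push_cast
    rw [h3]
    ring
  · obtain ⟨h, h1, h2, h3⟩ := odd_case hn
    rw [sum_orbitCount true false hK h1 h2, b1, b2, b3, b4, b5, b6, b7]
    push_cast
    rw [h3]
    ring
  · obtain ⟨h, h1, h2, h3⟩ := even_case hn
    rw [sum_orbitCount false false hK h1 h2, a1, a2, a3, a4, a5, a6, a7]
    push_cast
    rw [h3]
    ring
  · obtain ⟨h, h1, h2, h3⟩ := odd_case hn
    rw [sum_orbitCount false false hK h1 h2, a1, a2, a3, a4, a5, a6, a7]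
    push_cast
    rw [h3]
    ring
  · obtain ⟨h, h1, h2, h3⟩ := even_case hn
    rw [sum_orbitCount false true hK h1 h2, c1, c2, c3, c4, c5, c6, c7]
    push_cast
    rw [h3]
    ring
  · obtain ⟨h, h1, h2, h3⟩ := odd_case hn
    rw [sum_orbitCount false true hK h1 h2, c1, c2, c3, c4, c5, c6, c7]
    push_cast
    rw [h3]
    ring
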